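/- Let $N$ be a finite ground set and let $f_1,\dots,f_m:2^N\to\mathbb{R}$ be monotone submodular functions with $f_i(\emptyset)=0$, where submodular means $f_i(A\cup\{a\})-f_i(A)\le f_i(B\cup\{a\})-f_i(B)$ for all $B\subseteq A\subseteq N$ and $a\in N\setminus A$. Let $V_1,\dots,V_m>0$ and let $S_k\subseteq N$ be a set of size $k$ with $f_i(S_k)\ge V_i$ for all $i$. Let $0<\varepsilon<\frac{1}{8\ln m}$ (if $m\le 1$, the upper bound is no restriction: any $\varepsilon>0$). Then for every integer $k'$ with $m/\varepsilon^3\le k'\le k$ there is a subset $S_{k'}\subseteq S_k$ of size $k'$ such that $$f_i(S_{k'})\ \ge\ (1-\varepsilon)\,\frac{k'-m/\varepsilon^3}{k-m/\varepsilon^3}\,V_i\qquad\text{for all } i\in\{1,\dots,m\}.$$ (If $k=m/\varepsilon^3$, then $k'=k$ and $S_{k'}=S_k$ is forced; the quotient $0/0$ is then read as $0$.) -/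

import Mathlib

/-- A set function `f : 2^N → ℝ` is submodular: marginal values decrease as the set grows,
`f(A + a) - f(A) ≤ f(B + a) - f(B)` for all `B ⊆ A ⊆ N` and `a ∈ N \ A`. -/
def IsSubmodularSetFun {N : Type*} [DecidableEq N] (f : Finset N → ℝ) : Prop :=
  ∀ ⦃A B : Finset N⦄, B ⊆ A → ∀ a : N, a ∉ A →
    f (insert a A) - f A ≤ f (insert a B) - f B

/-- An objective: a normalized, monotone, submodular set function. -/
structure IsMonotoneSubmodular {N : Type*} [DecidableEq N] (f : Finset N → ℝ) : Prop where
  empty : f ∅ = 0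
  mono : Monotone f
  submodular : IsSubmodularSetFun f

/-! With targets `T i = q * V i`, a set `X` of at most `m / ε ^ 3` elements leaves every function
still below `(1 - ε) * T i` with marginals under `ε ^ 3 * T i` (`exists_subset_small_marginals`). A
random extension of `X` to size `k'` picks each remaining element with probability at least `q`, and
small marginals give a Chernoff lower tail. `exists_extension_sum_exp_le` derandomizes this by
conditional expectations; a union bound over at most `m` functions finishes. -/

open Finset in
theorem IsSubmodularSetFun.sub_le_sum {N : Type*} [DecidableEq N] {g : Finset N → ℝ}
    (hg : IsSubmodularSetFun g) (X A : Finset N) (hA : Disjoint X A) :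
    g (X ∪ A) - g X ≤ ∑ a ∈ A, (g (insert a X) - g X) := by
  induction A using Finset.induction_on with
  | empty => simp
  | insert a A ha ih =>
    rw [disjoint_insert_right] at hA
    have h := hg (A := X ∪ A) (B := X) subset_union_left a (by simp [hA.1, ha])
    rw [sum_insert ha, union_insert]
    linarith [ih hA.2]

theorem IsSubmodularSetFun.div_const {N : Type*} [DecidableEq N] {g : Finset N → ℝ}
    (hg : IsSubmodularSetFun g) {c : ℝ} (hc : 0 ≤ c) :
    IsSubmodularSetFun fun X => g X / c := by
  intro A B hBA a ha
  simpa only [← sub_div] using div_le_div_of_nonneg_right (hg hBA a ha) hc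

/-- A chord bound for `exp` combined with convexity in the exponent. -/
theorem exp_neg_mul_le_of_mem_unit {u p y : ℝ} (hp : 0 ≤ p) (hp1 : p ≤ 1)
    (hy : 0 ≤ y) (hy1 : y ≤ 1) :
    Real.exp (-((u - (1 - Real.exp (-u)) * p) * y)) ≤
      1 - y * ((1 - Real.exp (-u)) * (1 - p)) := by
  set w := 1 - Real.exp (-u) with hw
  have hwu : w ≤ u := by linarith [Real.add_one_le_exp (-u)]
  have h1 : Real.exp (-(u * y)) ≤ 1 - y * w := by
    have := convexOn_exp.2 (Set.mem_univ 0) (Set.mem_univ (-u)) (sub_nonneg.2 hy1) hy (by ring)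
    simp only [smul_eq_mul, mul_zero, zero_add, Real.exp_zero] at this
    calc Real.exp (-(u * y)) = Real.exp (y * -u) := by congr 1; ring
      _ ≤ _ := this
      _ = _ := by rw [hw]; ring
  have h2 : Real.exp (-((u - w) * y)) ≤ 1 :=
    Real.exp_le_one_iff.2 (neg_nonpos.2 (mul_nonneg (sub_nonneg.2 hwu) hy))
  have h3 := convexOn_exp.2 (Set.mem_univ (-(u * y))) (Set.mem_univ (-((u - w) * y)))
    (sub_nonneg.2 hp1) hp (by ring)
  simp only [smul_eq_mul] at h3
  calc Real.exp (-((u - w * p) * y))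
      = Real.exp ((1 - p) * -(u * y) + p * -((u - w) * y)) := by congr 1; ring
    _ ≤ _ := h3
    _ ≤ (1 - p) * (1 - y * w) + p * 1 :=
      add_le_add (mul_le_mul_of_nonneg_left h1 (sub_nonneg.2 hp1))
        (mul_le_mul_of_nonneg_left h2 hp)
    _ = _ := by ring

/-- The mean over one uniformly random new element of the exponential potential does not
exceed its current value. -/
theorem sum_exp_potential_le {N : Type*} [DecidableEq N] {g : Finset N → ℝ}
    (hmono : Monotone g) (hg : IsSubmodularSetFun g) {S X : Finset N} (hXS : X ⊆ S)
    (hsmall : ∀ a ∈ S \ X, g (insert a X) - g X ≤ 1) (u : ℝ) (hu : 0 ≤ u) {p p' : ℝ}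
    (hp : 0 ≤ p') (hp1 : p' ≤ 1) (hpp : ((S \ X).card : ℝ) * (p - p') = 1 - p') :
    ∑ a ∈ S \ X, Real.exp (-(u * g (insert a X) +
        (1 - Real.exp (-u)) * p' * (g S - g (insert a X)))) ≤
      (S \ X).card * Real.exp (-(u * g X + (1 - Real.exp (-u)) * p * (g S - g X))) := by
  set w := 1 - Real.exp (-u) with hw
  have hw0 : 0 ≤ w := sub_nonneg.2 (Real.exp_le_one_iff.2 (neg_nonpos.2 hu))
  set d : ℝ := ((S \ X).card : ℝ) with hd
  set E := Real.exp (-(u * g X + w * p' * (g S - g X))) with hE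
  have hD : g S - g X ≤ ∑ a ∈ S \ X, (g (insert a X) - g X) := by
    simpa [Finset.union_sdiff_of_subset hXS] using
      hg.sub_le_sum X (S \ X) Finset.disjoint_sdiff
  have hterm : ∀ a ∈ S \ X, Real.exp (-(u * g (insert a X) + w * p' * (g S - g (insert a X))))
      ≤ E * (1 - (g (insert a X) - g X) * (w * (1 - p'))) := by
    intro a ha
    have h := exp_neg_mul_le_of_mem_unit (u := u) hp hp1
      (sub_nonneg.2 (hmono (Finset.subset_insert a X))) (hsmall a ha)
    calc _ = E * Real.exp (-((u - w * p') * (g (insert a X) - g X))) := by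
          rw [hE, ← Real.exp_add]; congr 1; ring
      _ ≤ _ := mul_le_mul_of_nonneg_left h (Real.exp_pos _).le
  have hd0 : 0 ≤ d := Nat.cast_nonneg _
  -- By `hpp`, the average drop is exactly what raising `p'` to `p` pays for, via `1 + x ≤ exp x`.
  have hexp : d - w * (1 - p') * (g S - g X) ≤ d * Real.exp (-(w * (p - p') * (g S - g X))) := by
    have := mul_le_mul_of_nonneg_left (Real.add_one_le_exp (-(w * (p - p') * (g S - g X)))) hd0
    calc _ = d * (-(w * (p - p') * (g S - g X)) + 1) := by rw [← hpp]; ring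
      _ ≤ _ := this
  calc _ ≤ ∑ a ∈ S \ X, E * (1 - (g (insert a X) - g X) * (w * (1 - p'))) :=
        Finset.sum_le_sum hterm
    _ = E * (d - w * (1 - p') * ∑ a ∈ S \ X, (g (insert a X) - g X)) := by
        rw [← Finset.mul_sum, Finset.sum_sub_distrib, ← Finset.sum_mul]
        simp only [Finset.sum_const, nsmul_eq_mul, mul_one, ← hd]
        ring
    _ ≤ E * (d - w * (1 - p') * (g S - g X)) := by
        gcongr
    _ ≤ E * (d * Real.exp (-(w * (p - p') * (g S - g X)))) :=
        mul_le_mul_of_nonneg_left hexp (Real.exp_pos _).le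
    _ = _ := by
        rw [mul_left_comm, hE, ← Real.exp_add]; congr 2; ring

/-- Derandomized sampling without replacement: for functions with marginals at most `1`, some
extension of `X` by `r` elements of `S` has total exponential weight at most the bound that
holds on average. -/
theorem exists_extension_sum_exp_le {N ι : Type*} [DecidableEq N] (I : Finset ι)
    (g : ι → Finset N → ℝ) (hmono : ∀ i ∈ I, Monotone (g i))
    (hg : ∀ i ∈ I, IsSubmodularSetFun (g i)) (S : Finset N) (u : ℝ) (hu : 0 ≤ u) (r : ℕ) :
    ∀ X ⊆ S, r ≤ (S \ X).card → (∀ i ∈ I, ∀ a ∈ S \ X, g i (insert a X) - g i X ≤ 1) →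
      ∃ Y, X ⊆ Y ∧ Y ⊆ S ∧ Y.card = X.card + r ∧
        ∑ i ∈ I, Real.exp (-(u * g i Y)) ≤
          ∑ i ∈ I, Real.exp (-(u * g i X +
            (1 - Real.exp (-u)) * ((r : ℝ) / (S \ X).card) * (g i S - g i X))) := by
  induction r with
  | zero => exact fun X hX _ _ => ⟨X, subset_rfl, hX, rfl, by simp⟩
  | succ r ih =>
    intro X hX hr hsmall
    obtain ⟨e, hd⟩ : ∃ e, (S \ X).card = e + 1 := ⟨(S \ X).card - 1, by omega⟩
    rw [hd] at hr ⊢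
    have hre : (r : ℝ) ≤ e := by exact_mod_cast Nat.le_of_succ_le_succ hr
    have hp1 : (r : ℝ) / e ≤ 1 := div_le_one_of_le₀ hre (Nat.cast_nonneg _)
    have hpp : ((S \ X).card : ℝ) * (((r + 1 : ℕ) : ℝ) / ((e + 1 : ℕ) : ℝ) - (r : ℝ) / e) =
        1 - (r : ℝ) / e := by
      rw [hd]
      push_cast
      -- On the last element the new rate is `0 / 0 = 0`, and the identity survives.
      rcases Nat.eq_zero_or_pos e with rfl | he
      · have : r = 0 := by omega
        simp [this]
      · have : (e : ℝ) ≠ 0 := by positivity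
        field_simp
        ring
    have hsum : ∑ a ∈ S \ X, ∑ i ∈ I, Real.exp (-(u * g i (insert a X) +
        (1 - Real.exp (-u)) * ((r : ℝ) / e) * (g i S - g i (insert a X)))) ≤
        ∑ _a ∈ S \ X, ∑ i ∈ I, Real.exp (-(u * g i X + (1 - Real.exp (-u)) *
          (((r + 1 : ℕ) : ℝ) / ((e + 1 : ℕ) : ℝ)) * (g i S - g i X))) := by
      rw [Finset.sum_comm, Finset.sum_const, nsmul_eq_mul, Finset.mul_sum]
      exact Finset.sum_le_sum fun i hi => sum_exp_potential_le (hmono i hi) (hg i hi) hX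
        (hsmall i hi) u hu (by positivity) hp1 hpp
    obtain ⟨a, ha, hle⟩ := Finset.exists_le_of_sum_le (Finset.card_pos.1 (by omega)) hsum
    obtain ⟨haS, haX⟩ := Finset.mem_sdiff.1 ha
    have hcard : (S \ insert a X).card = e := by
      rw [Finset.sdiff_insert, Finset.card_erase_of_mem ha, hd, Nat.add_sub_cancel]
    obtain ⟨Y, hXY, hYS, hY, hsumY⟩ := ih (insert a X) (Finset.insert_subset haS hX)
      (by omega) (by
        intro i hi b hb
        rw [Finset.mem_sdiff] at hb
        exact (hg i hi (Finset.subset_insert a X) b hb.2).trans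
          (hsmall i hi b (Finset.mem_sdiff.2
            ⟨hb.1, fun h => hb.2 (Finset.mem_insert_of_mem h)⟩)))
    rw [hcard] at hsumY
    refine ⟨Y, (Finset.subset_insert a X).trans hXY, hYS, ?_, hsumY.trans hle⟩
    rw [hY, Finset.card_insert_of_notMem haX]
    ring

/-- A set of at most `m / δ` elements after which, for every function still below
`(1 - δ) T i`, each further element gains less than `δ * T i`. -/
theorem exists_subset_small_marginals {N : Type*} [DecidableEq N] {m : ℕ}
    (f : Fin m → Finset N → ℝ) (hmono : ∀ i, Monotone (f i)) (hf0 : ∀ i, f i ∅ = 0)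
    (T : Fin m → ℝ) (hT : ∀ i, 0 < T i) (δ : ℝ) (S : Finset N) :
    ∃ X ⊆ S, X.card * δ ≤ m ∧ ∀ i, f i X < (1 - δ) * T i → ∀ a ∈ S \ X,
      f i (insert a X) - f i X < δ * T i := by
  -- Truncation at `T i` caps the sum at `m`, hence bounds the size of `X`.
  obtain ⟨X, hX, hmax⟩ := (S.powerset.filter fun X => (X.card : ℝ) * δ ≤
      ∑ i, min (f i X) (T i) / T i).exists_max_image Finset.card
    ⟨∅, by simp [hf0, (hT _).le]⟩
  simp only [Finset.mem_filter, Finset.mem_powerset] at hX hmax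
  refine ⟨X, hX.1, hX.2.trans ?_, ?_⟩
  · calc _ ≤ ∑ _i : Fin m, (1 : ℝ) :=
          Finset.sum_le_sum fun i _ => div_le_one_of_le₀ (min_le_right _ _) (hT i).le
      _ = m := by simp
  · intro i hi a ha
    obtain ⟨haS, haX⟩ := Finset.mem_sdiff.1 ha
    by_contra! hgain
    have hstep : ∀ j, min (f j X) (T j) / T j ≤ min (f j (insert a X)) (T j) / T j := fun j =>
      div_le_div_of_nonneg_right
        (min_le_min_right _ (hmono j (Finset.subset_insert a X))) (hT j).le
    -- Below `(1 - δ) * T i`, a gain of `δ * T i` is not cut off by the truncation.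
    have hstep_i : δ ≤ min (f i (insert a X)) (T i) / T i - min (f i X) (T i) / T i := by
      rw [← sub_div, le_div_iff₀ (hT i), le_sub_iff_add_le]
      have := min_le_left (f i X) (T i)
      exact le_min (by linarith) (by linarith)
    have hsum : δ ≤ ∑ j, (min (f j (insert a X)) (T j) / T j - min (f j X) (T j) / T j) :=
      hstep_i.trans (Finset.single_le_sum (f := fun j =>
        min (f j (insert a X)) (T j) / T j - min (f j X) (T j) / T j)
        (fun j _ => sub_nonneg.2 (hstep j)) (Finset.mem_univ i))
    rw [Finset.sum_sub_distrib] at hsum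
    have hc := Finset.card_insert_of_notMem haX
    have := hmax (insert a X) ⟨Finset.insert_subset haS hX.1, by
      rw [hc]; push_cast; linarith [hX.2]⟩
    omega

theorem nat_mul_exp_neg_inv_lt_one {m : ℕ} {ε : ℝ} (hε : 0 < ε)
    (hεm : 2 ≤ m → ε < 1 / (8 * Real.log (m : ℝ))) : m * Real.exp (-(1 / (2 * ε))) < 1 := by
  rcases Nat.lt_or_ge m 2 with hm | hm
  · have h1 : Real.exp (-(1 / (2 * ε))) < 1 := Real.exp_lt_one_iff.2 (neg_neg_of_pos (by positivity))
    have h2 : (m : ℝ) ≤ 1 := by exact_mod_cast Nat.le_of_lt_succ hm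
    calc _ ≤ 1 * Real.exp (-(1 / (2 * ε))) := by gcongr
      _ < 1 := by simpa using h1
  · have hm0 : (0 : ℝ) < m := by positivity
    have hlog : 0 < Real.log m := Real.log_pos (by exact_mod_cast hm)
    have hlt : Real.log m < 1 / (2 * ε) := by
      have := hεm hm
      rw [lt_div_iff₀ (by positivity)] at this ⊢
      nlinarith [mul_pos hlog hε]
    calc _ = Real.exp (Real.log m + -(1 / (2 * ε))) := by rw [Real.exp_add, Real.exp_log hm0]
      _ < 1 := Real.exp_lt_one_iff.2 (by linarith)

/-- `(1 + u + u² / 2) * (1 - u + u² / 2) = 1 + u⁴ / 4 ≥ 1`. -/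
theorem exp_neg_le_one_sub_add_sq {u : ℝ} (hu : 0 ≤ u) (hu1 : u ≤ 1) :
    Real.exp (-u) ≤ 1 - u + u ^ 2 / 2 := by
  have h := Real.quadratic_le_exp_of_nonneg hu
  rw [Real.exp_neg, inv_le_comm₀ (Real.exp_pos _) (by nlinarith)]
  refine le_trans ?_ h
  rw [inv_le_comm₀ (by nlinarith) (by positivity), inv_le_iff_one_le_mul₀ (by positivity)]
  nlinarith [pow_nonneg hu 4]

theorem lemma10 {N : Type*} [Fintype N] [DecidableEq N] (m k : ℕ)
    (f : Fin m → Finset N → ℝ) (hf : ∀ i, IsMonotoneSubmodular (f i))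
    (V : Fin m → ℝ) (hV : ∀ i, 0 < V i)
    (ε : ℝ) (hε : 0 < ε) (hεm : 2 ≤ m → ε < 1 / (8 * Real.log (m : ℝ)))
    (S : Finset N) (hSk : S.card = k) (hSV : ∀ i, V i ≤ f i S) :
    ∀ k' : ℕ, (m : ℝ) / ε ^ 3 ≤ (k' : ℝ) → k' ≤ k →
      ∃ S' : Finset N, S' ⊆ S ∧ S'.card = k' ∧
        ∀ i, (1 - ε) * (((k' : ℝ) - (m : ℝ) / ε ^ 3) / ((k : ℝ) - (m : ℝ) / ε ^ 3)) * V i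
          ≤ f i S' := by
  intro k' hk' hk'k
  have hkk : (k' : ℝ) ≤ k := by exact_mod_cast hk'k
  set c : ℝ := (m : ℝ) / ε ^ 3 with hc
  set q : ℝ := ((k' : ℝ) - c) / ((k : ℝ) - c) with hq
  have hq0 : 0 ≤ q := div_nonneg (by linarith) (by linarith)
  have hnonneg : ∀ i X, 0 ≤ f i X := fun i X =>
    (hf i).empty ▸ (hf i).mono (Finset.empty_subset X)
  -- Covers `ε ≥ 1` and `q = 0`, including the quotient `0 / 0`.
  by_cases htriv : (1 - ε) * q ≤ 0
  · obtain ⟨S', hS', hcard⟩ := Finset.exists_subset_card_eq (hSk ▸ hk'k)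
    exact ⟨S', hS', hcard, fun i =>
      (mul_nonpos_of_nonpos_of_nonneg htriv (hV i).le).trans (hnonneg i S')⟩
  have hqpos : 0 < q := hq0.lt_of_ne fun h => htriv (by simp [← h])
  have hε1 : ε < 1 := by
    by_contra! h
    exact htriv (mul_nonpos_of_nonpos_of_nonneg (by linarith) hq0)
  have hkc : c < k' := by
    by_contra! h
    exact hqpos.ne' (by rw [hq, le_antisymm h hk', sub_self, zero_div])
  have hε3 : 0 < ε ^ 3 := by positivity
  have hε3' : ε ^ 3 ≤ ε := pow_le_of_le_one hε.le hε1.le (by norm_num)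
  have hT : ∀ i, 0 < q * V i := fun i => mul_pos hqpos (hV i)
  obtain ⟨X, hXS, hXcard, hX⟩ := exists_subset_small_marginals f (fun i => (hf i).mono)
    (fun i => (hf i).empty) (fun i => q * V i) hT (ε ^ 3) S
  have hXc : (X.card : ℝ) ≤ c := (le_div_iff₀ hε3).2 hXcard
  have hXk' : X.card < k' := by exact_mod_cast hXc.trans_lt hkc
  have hSX : (S \ X).card = k - X.card := by rw [Finset.card_sdiff_of_subset hXS, hSk]
  -- `(k' - x) / (k - x)` decreases in `x`, and `X.card ≤ c`.
  have hqp : q ≤ ((k' - X.card : ℕ) : ℝ) / (S \ X).card := by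
    rw [hSX, Nat.cast_sub hXk'.le, Nat.cast_sub (hXk'.le.trans hk'k), hq,
      div_le_div_iff₀ (by linarith) (by linarith)]
    nlinarith [mul_nonneg (sub_nonneg.2 hkk) (sub_nonneg.2 hXc)]
  have hp1 : ((k' - X.card : ℕ) : ℝ) / (S \ X).card ≤ 1 :=
    div_le_one_of_le₀ (by exact_mod_cast (by omega)) (Nat.cast_nonneg _)
  set τ : Fin m → ℝ := fun i => ε ^ 3 * (q * V i) with hτ
  have hτ0 : ∀ i, 0 < τ i := fun i => mul_pos hε3 (hT i)
  set I : Finset (Fin m) := Finset.univ.filter fun i => f i X < (1 - ε) * (q * V i) with hI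
  obtain ⟨Y, hXY, hYS, hY, hsum⟩ := exists_extension_sum_exp_le I (fun i Z => f i Z / τ i)
    (fun i _ A B hAB => div_le_div_of_nonneg_right ((hf i).mono hAB) (hτ0 i).le)
    (fun i _ => (hf i).submodular.div_const (hτ0 i).le) S ε hε.le (k' - X.card) X hXS
    (by omega) (by
      intro i hi a ha
      rw [← sub_div, div_le_one (hτ0 i)]
      refine (hX i ((Finset.mem_filter.1 hi).2.trans_le ?_) a ha).le
      exact mul_le_mul_of_nonneg_right (by linarith) (hT i).le)
  refine ⟨Y, hYS, by omega, fun i => ?_⟩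
  rw [mul_assoc]
  by_cases hi : i ∈ I
  swap
  · have : (1 - ε) * (q * V i) ≤ f i X := by simpa [hI] using hi
    exact this.trans ((hf i).mono hXY)
  by_contra! hlt
  set w := 1 - Real.exp (-ε) with hw
  set p : ℝ := ((k' - X.card : ℕ) : ℝ) / (S \ X).card with hp
  have hwε : w ≤ ε := by linarith [Real.add_one_le_exp (-ε)]
  have hw2 : ε - ε ^ 2 / 2 ≤ w := by linarith [exp_neg_le_one_sub_add_sq hε.le hε1.le]
  have hw0 : 0 ≤ w := by nlinarith
  have hupper : ∀ j ∈ I, Real.exp (-(ε * (f j X / τ j) + w * p * (f j S / τ j - f j X / τ j)))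
      ≤ Real.exp (-(w / ε ^ 3)) := by
    intro j _
    rw [Real.exp_le_exp, neg_le_neg_iff]
    have hx : 0 ≤ f j X / τ j := div_nonneg (hnonneg j X) (hτ0 j).le
    have hFq : 1 / ε ^ 3 ≤ p * (f j S / τ j) := by
      rw [← mul_div_assoc, div_le_div_iff₀ hε3 (hτ0 j), one_mul, mul_comm (p * f j S)]
      exact mul_le_mul_of_nonneg_left
        (mul_le_mul hqp (hSV j) (hV j).le (hq0.trans hqp)) hε3.le
    calc w / ε ^ 3 = w * (1 / ε ^ 3) := by ring
      _ ≤ w * (p * (f j S / τ j)) := mul_le_mul_of_nonneg_left hFq hw0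
      _ ≤ _ := by nlinarith [mul_nonneg (sub_nonneg.2 hwε) hx,
          mul_nonneg (mul_nonneg hw0 (sub_nonneg.2 hp1)) hx]
  have hlower : Real.exp (-(ε * (1 - ε) / ε ^ 3)) < Real.exp (-(ε * (f i Y / τ i))) := by
    rw [Real.exp_lt_exp, neg_lt_neg_iff, mul_div_assoc]
    refine mul_lt_mul_of_pos_left ?_ hε
    rw [div_lt_div_iff₀ (hτ0 i) hε3]
    calc f i Y * ε ^ 3 < (1 - ε) * (q * V i) * ε ^ 3 := mul_lt_mul_of_pos_right hlt hε3
      _ = _ := by simp only [hτ]; ring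
  have htotal : Real.exp (-(ε * (1 - ε) / ε ^ 3)) < m * Real.exp (-(w / ε ^ 3)) := by
    calc _ < _ := hlower
      _ ≤ ∑ j ∈ I, Real.exp (-(ε * (f j Y / τ j))) :=
        Finset.single_le_sum (f := fun j => Real.exp (-(ε * (f j Y / τ j))))
          (fun j _ => (Real.exp_pos _).le) hi
      _ ≤ _ := hsum
      _ ≤ ∑ _j ∈ I, Real.exp (-(w / ε ^ 3)) := Finset.sum_le_sum hupper
      _ ≤ ∑ _j : Fin m, Real.exp (-(w / ε ^ 3)) :=
        Finset.sum_le_univ_sum_of_nonneg fun _ => (Real.exp_pos _).le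
      _ = _ := by simp
  have hexp : Real.exp (-(w / ε ^ 3)) ≤
      Real.exp (-(1 / (2 * ε))) * Real.exp (-(ε * (1 - ε) / ε ^ 3)) := by
    rw [← Real.exp_add, Real.exp_le_exp, ← neg_add, neg_le_neg_iff]
    -- The gap `(ε - ε² / 2) - ε * (1 - ε) = ε² / 2`, divided by `ε ^ 3`, is the exponent that beats
    -- the factor `m`.
    have : 1 / (2 * ε) + ε * (1 - ε) / ε ^ 3 = (ε - ε ^ 2 / 2) / ε ^ 3 := by
      field_simp
      ring
    rw [this]
    exact div_le_div_of_nonneg_right hw2 hε3.le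
  have hpos := Real.exp_pos (-(ε * (1 - ε) / ε ^ 3))
  have := mul_le_mul_of_nonneg_left hexp (Nat.cast_nonneg (α := ℝ) m)
  nlinarith [mul_lt_mul_of_pos_right (nat_mul_exp_neg_inv_lt_one hε hεm) hpos]
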